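/- Let $\Phi$ be an infinite set of propositions and $a,b$ two agents. Formulas of $\mathcal{ONL}_n$ are built from the atoms $p\in\Phi$ with $\neg$, $\lor$ and the modal operators $\mathbf L_i,\mathbf N_i$ ($i\in\{a,b\}$); $\land,\supset$ are the usual abbreviations. Below $\Box_i$ stands for $\mathbf L_i$ or $\mathbf N_i$, and $j\ne i$. A formula is *basic* if it contains no $\mathbf N_i$. It is *$i$-objective* if every modal operator not in the scope of another one is a $\Box_j$ with $j\neq i$, and *$i$-subjective* if every atom is in the scope of a modal operator and every modal operator not in the scope of another one is a $\Box_i$. $\mathcal{ONL}_n^-$ is the set of formulas in which no $\mathbf N_j$ occurs in the scope of an $\mathbf L_i$ or $\mathbf N_i$ with $i\neq j$. The $i$-depth is given by $|p|_i=1$, $|\neg\alpha|_i=|\alpha|_i$, $|\alpha\lor\beta|_i=\max(|\alpha|_i,|\beta|_i)$, $|\Box_i\alpha|_i=|\alpha|_i$ and $|\Box_j\alpha|_i=|\alpha|_j+1$ for $j\ne i$. *Semantics.* A world is a subset of $\Phi$. Let $\mathbb E^0=\{\{\}\}$, and for $k\ge 1$ let a $k$-structure be a set $e^k\subseteq\mathcal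 W\times\mathbb E^{k-1}$, where $\mathcal W$ is the set of worlds and $\mathbb E^{k}$ the set of $k$-structures. A $(k,j)$-model is a triple $(e_a^k,e_b^j,w)$ with $e_a^k\in\mathbb E^k$, $e_b^j\in\mathbb E^j$, $w\in\mathcal W$. Truth is defined by $e_a^k,e_b^j,w\models p$ iff $p\in w$, the usual clauses for $\neg,\lor$, and: $e_a^k,e_b^j,w\models\mathbf L_a\alpha$ (resp. $\mathbf N_a\alpha$) iff $e_a^k,e_b^{k-1},w'\models\alpha$ for all $\langle w',e_b^{k-1}\rangle\in e_a^k$ (resp. for all $\langle w',e_b^{k-1}\rangle\in(\mathcal W\times\mathbb E^{k-1})\setminus e_a^k$); analogously for $b$. A formula $\alpha$ with $|\alpha|_a=k$, $|\alpha|_b=j$ is *valid*, $\models\alpha$, if it is true at all $(k,j)$-models. *Proof theory.* $\mathsf{K45}_n$ is the usual system for basic formulas: propositional tautologies, $\mathbf L_i(\alpha\supset\beta)\supset(\mathbf L_i\alpha\supset\mathbf L_i\beta)$, $\mathbf L_i\alpha\supset\mathbf L_i\mathbf L_i\alpha$, $\neg\mathbf L_i\alpha\supset\mathbf L_i\neg\mathbf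 L_i\alpha$, modus ponens, and necessitation for $\mathbf L_i$. The system $AX_n$ has modus ponens, necessitation for $\mathbf L_i$ and $\mathbf N_i$, and the axioms: all instances of propositional tautologies; $\mathbf L_i(\alpha\supset\beta)\supset(\mathbf L_i\alpha\supset\mathbf L_i\beta)$; $\mathbf N_i(\alpha\supset\beta)\supset(\mathbf N_i\alpha\supset\mathbf N_i\beta)$; $\sigma\supset\mathbf L_i\sigma\land\mathbf N_i\sigma$ for $i$-subjective $\sigma$; and $\mathbf N_i\alpha\supset\neg\mathbf L_i\alpha$ whenever $\neg\alpha$ is a $\mathsf{K45}_n$-consistent $i$-objective basic formula. A formula is consistent with a system if its negation is not provable in it. **Theorem.** Let $\alpha\in\mathcal{ONL}_n^-$. If $\models\alpha$, then $AX_n\vdash\alpha$. Moreover, if $\alpha$ is $AX_n$-consistent, with $|\alpha|_a=k$ and $|\alpha|_b=j$, then $\alpha$ is true at some $(2k+1,2j+1)$-model. -/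

import Mathlib

universe u

namespace OnlyKnowing

/-- The two agents, Alice and Bob. -/
inductive Agent where
  | a : Agent
  | b : Agent
  deriving DecidableEq

/-- Formulas of the propositional language `ONL_n` for two agents over the set `Φ` of
propositions: `L i α` says that agent `i` knows at least `α`, and `N i α` says that agent `i`
knows at most `¬ α`. -/
inductive Formula (Φ : Type u) : Type u where
  | atom : Φ → Formula Φ
  | neg : Formula Φ → Formula Φ
  | or : Formula Φ → Formula Φ → Formula Φ
  | L : Agent → Formula Φ → Formula Φ
  | N : Agent → Formula Φ → Formula Φ

namespace Formula

variable {Φ : Type u}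

/-- Material implication, as the usual abbreviation. -/
def imp (α β : Formula Φ) : Formula Φ := or (neg α) β

/-- Conjunction, as the usual abbreviation. -/
def and (α β : Formula Φ) : Formula Φ := neg (or (neg α) (neg β))

/-- `depth α i` is the `i`-depth of `α`. -/
def depth : Formula Φ → Agent → ℕ
  | atom _, _ => 1
  | neg α, i => depth α i
  | or α β, i => max (depth α i) (depth β i)
  | L j α, i => if j = i then depth α i else depth α j + 1
  | N j α, i => if j = i then depth α i else depth α j + 1

/-- `α` is `i`-objective: every epistemic operator of `α` outside the scope of all others
belongs to an agent different from `i`. -/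
def IsObjective (i : Agent) : Formula Φ → Prop
  | atom _ => True
  | neg α => IsObjective i α
  | or α β => IsObjective i α ∧ IsObjective i β
  | L j _ => j ≠ i
  | N j _ => j ≠ i

/-- `α` is `i`-subjective: every atom of `α` is in the scope of an epistemic operator, and every
epistemic operator of `α` outside the scope of all others belongs to agent `i`. -/
def IsSubjective (i : Agent) : Formula Φ → Prop
  | atom _ => False
  | neg α => IsSubjective i α
  | or α β => IsSubjective i α ∧ IsSubjective i β
  | L j _ => j = i
  | N j _ => j = i

/-- The operator `N_i` occurs in `α`. -/
def OccursN (i : Agent) : Formula Φ → Prop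
  | atom _ => False
  | neg α => OccursN i α
  | or α β => OccursN i α ∨ OccursN i β
  | L _ α => OccursN i α
  | N j α => j = i ∨ OccursN i α

/-- `α` is basic: it mentions no operator `N_i`. -/
def IsBasic (α : Formula Φ) : Prop := ∀ i, ¬ OccursN i α

/-- `α` belongs to `ONL_n^-`: no `N_j` occurs in the scope of an `L_i` or an `N_i` with
`i ≠ j`. -/
def IsONLMinus : Formula Φ → Prop
  | atom _ => True
  | neg α => IsONLMinus α
  | or α β => IsONLMinus α ∧ IsONLMinus β
  | L i α => IsONLMinus α ∧ ∀ j, j ≠ i → ¬ OccursN j α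
  | N i α => IsONLMinus α ∧ ∀ j, j ≠ i → ¬ OccursN j α

/-- Truth of `α` in the propositional sense, where atoms and formulas that start with an epistemic
operator get their truth values from `v`. -/
def PropTrue (v : Formula Φ → Prop) : Formula Φ → Prop
  | atom p => v (atom p)
  | neg α => ¬ PropTrue v α
  | or α β => PropTrue v α ∨ PropTrue v β
  | L i α => v (L i α)
  | N i α => v (N i α)

/-- `α` is an instance of a propositional tautology. -/
def IsTautology (α : Formula Φ) : Prop := ∀ v : Formula Φ → Prop, PropTrue v α

end Formula

open Formula hiding and or

section ProofTheory

variable {Φ : Type u}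

/-- Provability in `K45_n`, formulated in the basic language. -/
inductive K45Provable : Formula Φ → Prop
  | taut (α : Formula Φ) : IsBasic α → IsTautology α → K45Provable α
  | axK (i : Agent) (α β : Formula Φ) : IsBasic α → IsBasic β →
      K45Provable (imp (L i (imp α β)) (imp (L i α) (L i β)))
  | ax4 (i : Agent) (α : Formula Φ) : IsBasic α →
      K45Provable (imp (L i α) (L i (L i α)))
  | ax5 (i : Agent) (α : Formula Φ) : IsBasic α →
      K45Provable (imp (neg (L i α)) (L i (neg (L i α))))
  | mp (α β : Formula Φ) : K45Provable (imp α β) → K45Provable α → K45Provable β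
  | nec (i : Agent) (α : Formula Φ) : K45Provable α → K45Provable (L i α)

/-- `α` is consistent with `K45_n`. -/
def K45Consistent (α : Formula Φ) : Prop := ¬ K45Provable (neg α)

/-- Provability in the axiom system `AX_n`. -/
inductive AXProvable : Formula Φ → Prop
  | a1 (α : Formula Φ) : IsTautology α → AXProvable α
  | a2 (i : Agent) (α β : Formula Φ) :
      AXProvable (imp (L i (imp α β)) (imp (L i α) (L i β)))
  | a3 (i : Agent) (α β : Formula Φ) :
      AXProvable (imp (N i (imp α β)) (imp (N i α) (N i β)))
  | a4 (i : Agent) (σ : Formula Φ) : IsSubjective i σ →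
      AXProvable (imp σ (Formula.and (L i σ) (N i σ)))
  | a5 (i : Agent) (α : Formula Φ) : IsBasic (neg α) → IsObjective i (neg α) →
      K45Consistent (neg α) → AXProvable (imp (N i α) (neg (L i α)))
  | mp (α β : Formula Φ) : AXProvable (imp α β) → AXProvable α → AXProvable β
  | necL (i : Agent) (α : Formula Φ) : AXProvable α → AXProvable (L i α)
  | necN (i : Agent) (α : Formula Φ) : AXProvable α → AXProvable (N i α)

/-- `α` is consistent with `AX_n`. -/
def AXConsistent (α : Formula Φ) : Prop := ¬ AXProvable (neg α)

end ProofTheory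

/-- A world is a set of propositions: those that are true at it. -/
abbrev World (Φ : Type u) : Type u := Set Φ

/-- The type of all `k`-structures. For `k ≥ 1` a `k`-structure is a set of pairs of a world and
a `(k - 1)`-structure of the other agent; the empty tuple, written `{}` in `W × {{}}`, is the only
`0`-structure. -/
def Str (Φ : Type u) : ℕ → Type u
  | 0 => PUnit
  | k + 1 => Set (World Φ × Str Φ k)

section Semantics

variable {Φ : Type u}

/-- The set of pairs that a `(k + 1)`-structure is. -/
def Str.pairs {k : ℕ} (e : Str Φ (k + 1)) : Set (World Φ × Str Φ k) := e

/-- `Sat α k j ea eb w` says that `α` is true at the `(k, j)`-model `(ea, eb, w)`. The clauses with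
the `0`-structure for the agent of the operator (where there are no pairs to range over) are
never reached from a formula whose `a`-depth is at most `k` and `b`-depth at most `j`. -/
def Sat : Formula Φ → (k j : ℕ) → Str Φ k → Str Φ j → World Φ → Prop
  | .atom p, _, _, _, _, w => p ∈ w
  | .neg α, k, j, ea, eb, w => ¬ Sat α k j ea eb w
  | .or α β, k, j, ea, eb, w => Sat α k j ea eb w ∨ Sat β k j ea eb w
  | .L .a _, 0, _, _, _, _ => True
  | .L .a α, k + 1, _, ea, _, _ =>
      ∀ (w' : World Φ) (eb' : Str Φ k),
        (w', eb') ∈ ea.pairs → Sat α (k + 1) k ea eb' w'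
  | .N .a _, 0, _, _, _, _ => True
  | .N .a α, k + 1, _, ea, _, _ =>
      ∀ (w' : World Φ) (eb' : Str Φ k),
        (w', eb') ∉ ea.pairs → Sat α (k + 1) k ea eb' w'
  | .L .b _, _, 0, _, _, _ => True
  | .L .b α, _, j + 1, _, eb, _ =>
      ∀ (w' : World Φ) (ea' : Str Φ j),
        (w', ea') ∈ eb.pairs → Sat α j (j + 1) ea' eb w'
  | .N .b _, _, 0, _, _, _ => True
  | .N .b α, _, j + 1, _, eb, _ =>
      ∀ (w' : World Φ) (ea' : Str Φ j),
        (w', ea') ∉ eb.pairs → Sat α j (j + 1) ea' eb w'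

/-- `α`, of `a`-depth `k` and `b`-depth `j`, is valid: it is true at all `(k, j)`-models. -/
def Valid (α : Formula Φ) : Prop :=
  ∀ (ea : Str Φ (depth α .a)) (eb : Str Φ (depth α .b)) (w : World Φ),
    Sat α (depth α .a) (depth α .b) ea eb w

/-- `α` is satisfiable by a `(k, j)`-model. -/
def SatisfiableAt (α : Formula Φ) (k j : ℕ) : Prop :=
  ∃ (ea : Str Φ k) (eb : Str Φ j) (w : World Φ), Sat α k j ea eb w

end Semantics

end OnlyKnowing

/-!
The proof is a Henkin construction carried out with complete theories of `AX_n` only; the result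
is satisfiability of a consistent formula of `ONL_n^-` at every `(k, j)`-model size that is at
least its depth, from which both claims follow.

Basic formulas. A complete theory `Γ` has the usual accessibility relations `Γ.Acc i`, and by axiom
A4 the points accessible from `Γ` for agent `i` have the same `i`-alternatives as `Γ`. Unravelling
these relations to depth `k` gives a `k`-structure `basicStr i k Γ`, at which a basic formula of
sufficiently small rank holds iff it is in `Γ` (`CompleteTheory.satFor_basicStr`). Conversely
`K45_n` is sound for `Sat` at all sizes (`K45Provable.sat`), because the junk clauses of `Sat` make
`L_i` vacuous at a `0`-structure, exactly as in a Kripke model at a point without successors.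

Operators `N_i`. Let `q` be an atom outside the given formula; it exists since `Φ` is infinite. For
a complete theory `Γ`, the structure `Γ.fullStr q i (k + 1)` consists of the pairs `(w, e)` that
satisfy all `β` with `L_i β ∈ Γ` and, if they also satisfy all `β` with `N_i β ∈ Γ`, have `q ∈ w`;
here `β` ranges over the `i`-objective basic formulas without `q` of rank at most `k`. Axiom A5 and
soundness of `K45_n` show that each pair meets one of the two requirements, so that the complement
satisfies all `β` with `N_i β ∈ Γ`. A formula `β` with `L_i β ∉ Γ` or `N_i β ∉ Γ` is refuted at a
pair obtained from a complete theory, and changing the value of `q` moves this pair to the inside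
or the outside of the structure as required. Hence `Γ.fullStr` treats `L_i β` and `N_i β`
correctly (`CompleteTheory.L_mem_iff_fullStr`, `CompleteTheory.N_mem_iff_fullStr`).

Nesting. In `ONL_n^-` the argument of an operator of `i` is a Boolean combination of `i`-objective
basic formulas and of formulas that start with an operator of `i`. The latter may be replaced by
truth constants according to whether they are in `Γ`, by axiom A4 on the side of proofs
(`CompleteTheory.mem_iff_reduce_mem`) and by induction on the side of truth
(`CompleteTheory.satFor_reduce`), which leaves the case already treated.
-/

namespace OnlyKnowing

open Formula hiding and or

variable {Φ : Type u}

/-! ### Agents, atoms and ranks -/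

/-- The agent different from the given one. -/
def Agent.other : Agent → Agent
  | .a => .b
  | .b => .a

@[simp] theorem Agent.other_other (i : Agent) : i.other.other = i := by cases i <;> rfl

theorem Agent.other_ne (i : Agent) : i.other ≠ i := by cases i <;> simp [Agent.other]

theorem Agent.eq_or_eq_other (l i : Agent) : l = i ∨ l = i.other := by
  cases l <;> cases i <;> simp [Agent.other]

namespace Formula

/-- The atom `q` occurs in the formula. -/
def Mentions (q : Φ) : Formula Φ → Prop
  | atom p => p = q
  | neg α => Mentions q α
  | or α β => Mentions q α ∨ Mentions q β
  | L _ α => Mentions q α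
  | N _ α => Mentions q α

theorem finite_mentions (α : Formula Φ) : {q | α.Mentions q}.Finite := by
  induction α with
  | atom p => exact (Set.finite_singleton p).subset fun q h => h.symm
  | neg α ih => exact ih
  | or α β ihα ihβ => exact ihα.union ihβ
  | L i α ih => exact ih
  | N i α ih => exact ih

/-- The number of levels of a structure of agent `i` that the truth value of the formula depends
on. It is at most the `i`-depth, which also counts atoms and operators of the other agent. -/
def rank : Formula Φ → Agent → ℕ
  | atom _, _ => 0
  | neg α, i => rank α i
  | or α β, i => max (rank α i) (rank β i)
  | L l α, i => if l = i then max (rank α i) (rank α i.other + 1) else 0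
  | N l α, i => if l = i then max (rank α i) (rank α i.other + 1) else 0

/-- The second inequality is what makes the induction go through below an operator. -/
theorem rank_le_depth (α : Formula Φ) (i : Agent) :
    α.rank i ≤ α.depth i ∧ α.rank i.other + 1 ≤ α.depth i := by
  induction α generalizing i with
  | atom p => simp [rank, depth]
  | neg α ih => exact ih i
  | or α β ihα ihβ =>
    have := ihα i
    have := ihβ i
    simp only [rank, depth]
    omega
  | L l α ih | N l α ih =>
    have h := ih l
    rcases l.eq_or_eq_other i with rfl | rfl
    · simp only [rank, depth, if_true, if_neg (Agent.other_ne l).symm]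
      omega
    · simp only [rank, depth, if_true, if_neg (Agent.other_ne i), Agent.other_other] at h ⊢
      omega

theorem IsBasic.of_neg {α : Formula Φ} (h : IsBasic (neg α)) : IsBasic α := h

theorem IsBasic.of_or {α β : Formula Φ} (h : IsBasic (or α β)) : IsBasic α ∧ IsBasic β :=
  ⟨fun i hi => h i (Or.inl hi), fun i hi => h i (Or.inr hi)⟩

theorem IsBasic.of_L {i : Agent} {α : Formula Φ} (h : IsBasic (L i α)) : IsBasic α := h

theorem not_isBasic_N (i : Agent) (α : Formula Φ) : ¬ IsBasic (N i α) :=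
  fun h => h i (Or.inl rfl)

end Formula

/-! ### Truth from the point of view of an agent -/

/-- Truth with the structure of agent `i` listed first, so that the two agents can be treated
alike. -/
def SatFor (i : Agent) (α : Formula Φ) (k m : ℕ) (e : Str Φ k) (e' : Str Φ m) (w : World Φ) :
    Prop :=
  match i with
  | .a => Sat α k m e e' w
  | .b => Sat α m k e' e w

theorem satFor_other {i : Agent} {α : Formula Φ} {k m : ℕ} {e : Str Φ k} {e' : Str Φ m}
    {w : World Φ} : SatFor i.other α k m e e' w ↔ SatFor i α m k e' e w := by
  cases i <;> rfl

theorem satFor_atom {i : Agent} {p : Φ} {k m : ℕ} {e : Str Φ k} {e' : Str Φ m} {w : World Φ} :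
    SatFor i (atom p) k m e e' w ↔ p ∈ w := by
  cases i <;> simp [SatFor, Sat]

theorem satFor_neg {i : Agent} {α : Formula Φ} {k m : ℕ} {e : Str Φ k} {e' : Str Φ m}
    {w : World Φ} : SatFor i (neg α) k m e e' w ↔ ¬ SatFor i α k m e e' w := by
  cases i <;> simp [SatFor, Sat]

theorem satFor_or {i : Agent} {α β : Formula Φ} {k m : ℕ} {e : Str Φ k} {e' : Str Φ m}
    {w : World Φ} :
    SatFor i (Formula.or α β) k m e e' w ↔ SatFor i α k m e e' w ∨ SatFor i β k m e e' w := by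
  cases i <;> simp [SatFor, Sat]

theorem satFor_L {i : Agent} {α : Formula Φ} {k m : ℕ} {e : Str Φ (k + 1)} {e' : Str Φ m}
    {w : World Φ} :
    SatFor i (L i α) (k + 1) m e e' w ↔
      ∀ w' f, (w', f) ∈ e.pairs → SatFor i α (k + 1) k e f w' := by
  cases i <;> simp [SatFor, Sat]

theorem satFor_N {i : Agent} {α : Formula Φ} {k m : ℕ} {e : Str Φ (k + 1)} {e' : Str Φ m}
    {w : World Φ} :
    SatFor i (N i α) (k + 1) m e e' w ↔
      ∀ w' f, (w', f) ∉ e.pairs → SatFor i α (k + 1) k e f w' := by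
  cases i <;> simp [SatFor, Sat]

/-- An `i`-objective formula does not depend on the structure of agent `i`. -/
theorem satFor_congr_of_isObjective {i : Agent} {α : Formula Φ} (hα : α.IsObjective i)
    {k k' m : ℕ} (e : Str Φ k) (f : Str Φ k') {e' : Str Φ m} {w : World Φ} :
    SatFor i α k m e e' w ↔ SatFor i α k' m f e' w := by
  induction α with
  | atom p => simp only [satFor_atom]
  | neg α ih => simp only [satFor_neg, ih hα]
  | or α β ihα ihβ => simp only [satFor_or, ihα hα.1, ihβ hα.2]
  | L l α _ | N l α _ =>
    cases i <;> cases l <;> first | exact absurd rfl hα | (cases m <;> simp [SatFor, Sat])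

theorem satFor_congr_of_not_mentions {i : Agent} {q : Φ} {α : Formula Φ} (hα : ¬ α.Mentions q)
    {k m : ℕ} {e : Str Φ k} {e' : Str Φ m} {w w' : World Φ} (hw : ∀ p, p ≠ q → (p ∈ w ↔ p ∈ w')) :
    SatFor i α k m e e' w ↔ SatFor i α k m e e' w' := by
  induction α with
  | atom p => simpa only [satFor_atom] using hw p hα
  | neg α ih => simp only [satFor_neg, ih hα]
  | or α β ihα ihβ =>
    simp only [satFor_or, ihα fun h => hα (Or.inl h), ihβ fun h => hα (Or.inr h)]
  | L l α _ | N l α _ => cases i <;> cases l <;> cases k <;> cases m <;> simp [SatFor, Sat]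

/-! ### Soundness of K45 -/

theorem sat_iff_propTrue (α : Formula Φ) {k j : ℕ} {ea : Str Φ k} {eb : Str Φ j} {w : World Φ} :
    Sat α k j ea eb w ↔ α.PropTrue fun β => Sat β k j ea eb w := by
  induction α with
  | atom p => rfl
  | neg α ih => simp only [Sat, PropTrue, ih]
  | or α β ihα ihβ => simp only [Sat, PropTrue, ihα, ihβ]
  | L i α _ | N i α _ => rfl

/-- No bound on the depth is needed: at a `0`-structure the clauses of `Sat` make `L_i` vacuously
true, which is compatible with all axioms of `K45_n`. -/
theorem K45Provable.sat {α : Formula Φ} (h : K45Provable α) :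
    ∀ (k j : ℕ) (ea : Str Φ k) (eb : Str Φ j) (w : World Φ), Sat α k j ea eb w := by
  induction h with
  | taut α _ hα => exact fun k j ea eb w => (sat_iff_propTrue α).2 (hα _)
  | axK i α β _ _ =>
    intro k j ea eb w
    cases i <;> cases k <;> cases j <;> simp only [imp, Sat] <;> grind
  | ax4 i α _ | ax5 i α _ =>
    intro k j ea eb w
    cases i <;> cases k <;> cases j <;> simp only [imp, Sat] <;> grind
  | mp α β _ _ ih₁ ih₂ =>
    intro k j ea eb w
    exact (ih₁ k j ea eb w).resolve_left fun h => h (ih₂ k j ea eb w)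
  | nec i α _ ih =>
    intro k j ea eb w
    cases i <;> cases k <;> cases j <;> simp only [Sat] <;> intros <;> apply ih

/-! ### Theories and complete theories -/

/-- A set of formulas that contains the theorems of `AX_n` and is closed under modus ponens. -/
structure IsTheory (T : Set (Formula Φ)) : Prop where
  provable {α : Formula Φ} : AXProvable α → α ∈ T
  mp {α β : Formula Φ} : imp α β ∈ T → α ∈ T → β ∈ T

namespace IsTheory

variable {T : Set (Formula Φ)}

theorem taut (hT : IsTheory T) {α : Formula Φ} (h : IsTautology α) : α ∈ T :=
  hT.provable (.a1 _ h)

theorem taut_mp (hT : IsTheory T) {α β : Formula Φ} (h : IsTautology (imp α β)) (hα : α ∈ T) :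
    β ∈ T :=
  hT.mp (hT.taut h) hα

theorem taut_mp₂ (hT : IsTheory T) {α β γ : Formula Φ} (h : IsTautology (imp α (imp β γ)))
    (hα : α ∈ T) (hβ : β ∈ T) : γ ∈ T :=
  hT.mp (hT.taut_mp h hα) hβ

theorem unboxL (hT : IsTheory T) (i : Agent) : IsTheory {α | L i α ∈ T} where
  provable h := hT.provable (.necL i _ h)
  mp h₁ h₂ := hT.mp (hT.mp (hT.provable (.a2 i _ _)) h₁) h₂

theorem unboxN (hT : IsTheory T) (i : Agent) : IsTheory {α | N i α ∈ T} where
  provable h := hT.provable (.necN i _ h)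
  mp h₁ h₂ := hT.mp (hT.mp (hT.provable (.a3 i _ _)) h₁) h₂

theorem mem_of_isSubjective (hT : IsTheory T) {i : Agent} {σ : Formula Φ} (hσ : σ.IsSubjective i)
    (h : σ ∈ T) : L i σ ∈ T ∧ N i σ ∈ T := by
  have h' := hT.mp (hT.provable (.a4 i σ hσ)) h
  constructor
  · refine hT.taut_mp (fun v => ?_) h'
    simp only [imp, Formula.and, PropTrue]
    tauto
  · refine hT.taut_mp (fun v => ?_) h'
    simp only [imp, Formula.and, PropTrue]
    tauto

end IsTheory

theorem isTheory_setOf_axProvable : IsTheory {α : Formula Φ | AXProvable α} where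
  provable h := h
  mp := .mp _ _

/-- A complete theory: a theory that contains exactly one of `α` and `¬ α`, for each `α`. -/
structure CompleteTheory (Φ : Type u) where
  /-- The formulas of the theory. -/
  carrier : Set (Formula Φ)
  isTheory : IsTheory carrier
  neg_mem_iff : ∀ α, neg α ∈ carrier ↔ α ∉ carrier

instance : Membership (Formula Φ) (CompleteTheory Φ) := ⟨fun Γ α => α ∈ Γ.carrier⟩

/-- Lindenbaum's lemma. -/
theorem IsTheory.exists_completeTheory {T : Set (Formula Φ)} (hT : IsTheory T) {β : Formula Φ}
    (hβ : β ∉ T) : ∃ Γ : CompleteTheory Φ, (∀ α ∈ T, α ∈ Γ) ∧ β ∉ Γ := by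
  obtain ⟨M, hTM, hM⟩ := zorn_subset_nonempty {U : Set (Formula Φ) | IsTheory U ∧ β ∉ U}
    (fun c hc hchain hne => by
      refine ⟨⋃₀ c, ⟨⟨fun h => ?_, ?_⟩, ?_⟩, fun s => Set.subset_sUnion_of_mem⟩
      · obtain ⟨s, hs⟩ := hne
        exact ⟨s, hs, (hc hs).1.provable h⟩
      · rintro α γ ⟨s, hs, h₁⟩ ⟨t, ht, h₂⟩
        rcases hchain.total hs ht with hst | hts
        · exact ⟨t, ht, (hc ht).1.mp (hst h₁) h₂⟩
        · exact ⟨s, hs, (hc hs).1.mp h₁ (hts h₂)⟩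
      · rintro ⟨s, hs, h⟩
        exact (hc hs).2 h) T ⟨hT, hβ⟩
  have hth := hM.prop.1
  -- The formulas implied by `γ` relative to `M` form a theory, so maximality applies to them.
  have key : ∀ γ, γ ∉ M → imp γ β ∈ M := by
    intro γ hγ
    by_contra hcon
    have hU : IsTheory {δ | imp γ δ ∈ M} := by
      refine ⟨fun h => hth.taut_mp (fun v => ?_) (hth.provable h),
        fun h₁ h₂ => hth.taut_mp₂ (fun v => ?_) h₁ h₂⟩
      · simp only [imp, PropTrue]
        tauto
      · simp only [imp, PropTrue]
        tauto
    refine hγ (hM.le_of_ge ⟨hU, hcon⟩ (fun δ hδ => hth.taut_mp (fun v => ?_) hδ)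
      (hth.taut fun v => ?_))
    · simp only [imp, PropTrue]
      tauto
    · simp only [imp, PropTrue]
      tauto
  refine ⟨⟨M, hth, fun γ => ⟨fun h₁ h₂ => ?_, fun h => ?_⟩⟩, hTM, hM.prop.2⟩
  · refine hM.prop.2 (hth.taut_mp₂ (fun v => ?_) h₁ h₂)
    simp only [imp, PropTrue]
    tauto
  · by_contra h'
    refine hM.prop.2 (hth.taut_mp₂ (fun v => ?_) (key _ h) (key _ h'))
    simp only [imp, PropTrue]
    tauto

namespace CompleteTheory

variable (Γ Δ : CompleteTheory Φ)

theorem neg_mem (α : Formula Φ) : neg α ∈ Γ ↔ α ∉ Γ := Γ.neg_mem_iff α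

theorem or_mem (α β : Formula Φ) : Formula.or α β ∈ Γ ↔ α ∈ Γ ∨ β ∈ Γ := by
  constructor
  · intro h
    by_contra! hn
    refine (Γ.neg_mem β).1 ?_ (Γ.isTheory.taut_mp₂ (fun v => ?_) h ((Γ.neg_mem α).2 hn.1))
    · exact (Γ.neg_mem β).2 hn.2
    · simp only [imp, PropTrue]
      tauto
  · rintro (h | h)
    · refine Γ.isTheory.taut_mp (fun v => ?_) h
      simp only [imp, PropTrue]
      tauto
    · refine Γ.isTheory.taut_mp (fun v => ?_) h
      simp only [imp, PropTrue]
      tauto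

/-- `Δ` is accessible from `Γ` for agent `i`. -/
def Acc (i : Agent) : Prop := ∀ α, L i α ∈ Γ → α ∈ Δ

variable {Γ Δ}

theorem L_mem_iff {i : Agent} {α : Formula Φ} : L i α ∈ Γ ↔ ∀ Δ, Γ.Acc Δ i → α ∈ Δ := by
  refine ⟨fun h Δ hΔ => hΔ α h, fun h => ?_⟩
  by_contra hα
  obtain ⟨Δ, hΔ, hn⟩ := (Γ.isTheory.unboxL i).exists_completeTheory (β := α) hα
  exact hn (h Δ hΔ)

theorem Acc.L_mem_iff {i : Agent} (h : Γ.Acc Δ i) {α : Formula Φ} : L i α ∈ Γ ↔ L i α ∈ Δ := by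
  refine ⟨fun hα => h _ (Γ.isTheory.mem_of_isSubjective (σ := L i α) rfl hα).1, fun hα => ?_⟩
  by_contra hn
  exact (Δ.neg_mem _).1
    (h _ (Γ.isTheory.mem_of_isSubjective (σ := neg (L i α)) rfl ((Γ.neg_mem _).2 hn)).1) hα

variable (Γ)

/-- The world described by a complete theory. -/
def world : World Φ := {p | atom p ∈ Γ}

/-! ### The canonical structures for basic formulas -/

/-- The `k`-structure of agent `i` obtained by unravelling the accessibility relations. -/
def basicStr (i : Agent) : (k : ℕ) → CompleteTheory Φ → Str Φ k
  | 0, _ => PUnit.unit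
  | k + 1, Γ => {π | ∃ Δ, Γ.Acc Δ i ∧ π = (Δ.world, basicStr i.other k Δ)}

theorem mem_pairs_basicStr {i : Agent} {k : ℕ} {Γ : CompleteTheory Φ} {π : World Φ × Str Φ k} :
    π ∈ (basicStr i (k + 1) Γ).pairs ↔
      ∃ Δ, Γ.Acc Δ i ∧ π = (Δ.world, basicStr i.other k Δ) :=
  Iff.rfl

theorem Acc.basicStr_eq {i : Agent} {Γ Δ : CompleteTheory Φ} (h : Γ.Acc Δ i) (k : ℕ) :
    basicStr i k Γ = basicStr i k Δ := by
  cases k with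
  | zero => rfl
  | succ k =>
    simp only [basicStr, Acc, h.L_mem_iff]
    rfl

theorem satFor_basicStr {β : Formula Φ} (hβ : β.IsBasic) (Γ : CompleteTheory Φ) (i : Agent)
    {k m : ℕ} (hk : β.rank i ≤ k) (hm : β.rank i.other ≤ m) :
    SatFor i β k m (basicStr i k Γ) (basicStr i.other m Γ) Γ.world ↔ β ∈ Γ := by
  induction β generalizing Γ i k m with
  | atom p => exact satFor_atom
  | neg α ih => rw [satFor_neg, neg_mem, ih hβ.of_neg Γ i hk hm]
  | or α β ihα ihβ =>
    simp only [rank, max_le_iff] at hk hm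
    rw [satFor_or, or_mem, ihα hβ.of_or.1 Γ i hk.1 hm.1, ihβ hβ.of_or.2 Γ i hk.2 hm.2]
  | L l α ih =>
    -- The view of agent `l` may be taken, by exchanging the two structures if necessary.
    have key : ∀ {k m : ℕ} (e' : Str Φ m), (L l α).rank l ≤ k →
        (SatFor l (L l α) k m (basicStr l k Γ) e' Γ.world ↔ L l α ∈ Γ) := by
      intro k m e' hk
      simp only [rank, if_true, max_le_iff] at hk
      obtain ⟨k, rfl⟩ : ∃ k', k = k' + 1 := ⟨k - 1, by omega⟩
      rw [satFor_L, CompleteTheory.L_mem_iff]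
      have hstep : ∀ Δ, Γ.Acc Δ l →
          (SatFor l α (k + 1) k (basicStr l (k + 1) Γ) (basicStr l.other k Δ) Δ.world ↔ α ∈ Δ) :=
        fun Δ hΔ => by rw [hΔ.basicStr_eq, ih hβ.of_L Δ l hk.1 (by omega)]
      constructor
      · intro h Δ hΔ
        exact (hstep Δ hΔ).1 (h _ _ (mem_pairs_basicStr.2 ⟨Δ, hΔ, rfl⟩))
      · rintro h w' f hf
        obtain ⟨Δ, hΔ, hπ⟩ := mem_pairs_basicStr.1 hf
        obtain ⟨rfl, rfl⟩ := Prod.mk.inj hπ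
        exact (hstep Δ hΔ).2 (h Δ hΔ)
    rcases l.eq_or_eq_other i with rfl | rfl
    · exact key _ hk
    · rw [← satFor_other]
      exact key _ hm
  | N l α _ => exact absurd hβ (not_isBasic_N l α)

end CompleteTheory

/-! ### Structures that also interpret `N` correctly -/

/-- The formulas on which `CompleteTheory.fullStr` is based: basic `i`-objective formulas without
the atom `q` that depend only on `k` levels of the structure of the other agent. -/
structure IsTest (q : Φ) (i : Agent) (k : ℕ) (β : Formula Φ) : Prop where
  isBasic : β.IsBasic
  isObjective : β.IsObjective i
  not_mentions : ¬ β.Mentions q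
  rank_le : β.rank i.other ≤ k

/-- The pair `π`, as a possible element of a `(k + 1)`-structure of agent `i`, satisfies `β`. The
structure of agent `i` is a dummy, which is harmless when `β` is `i`-objective. -/
def HoldsAt (i : Agent) {k : ℕ} (π : World Φ × Str Φ k) (β : Formula Φ) : Prop :=
  SatFor i β 0 k PUnit.unit π.2 π.1

theorem IsTest.satFor_iff {q : Φ} {i : Agent} {k : ℕ} {β : Formula Φ} (hβ : IsTest q i k β)
    {m : ℕ} (e : Str Φ m) (π : World Φ × Str Φ k) :
    SatFor i β m k e π.2 π.1 ↔ HoldsAt i π β :=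
  satFor_congr_of_isObjective hβ.isObjective _ _

theorem IsTest.holdsAt_congr {q : Φ} {i : Agent} {k : ℕ} {β : Formula Φ} (hβ : IsTest q i k β)
    {w w' : World Φ} (f : Str Φ k) (hw : ∀ p, p ≠ q → (p ∈ w ↔ p ∈ w')) :
    HoldsAt i (w, f) β ↔ HoldsAt i (w', f) β :=
  satFor_congr_of_not_mentions hβ.not_mentions hw

theorem IsTest.holdsAt_basicStr {q : Φ} {i : Agent} {k : ℕ} {β : Formula Φ} (hβ : IsTest q i k β)
    (Δ : CompleteTheory Φ) : HoldsAt i (Δ.world, CompleteTheory.basicStr i.other k Δ) β ↔ β ∈ Δ := by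
  rw [← hβ.satFor_iff (CompleteTheory.basicStr i (β.rank i) Δ)]
  exact CompleteTheory.satFor_basicStr hβ.isBasic Δ i le_rfl hβ.rank_le

/-- The pair satisfies all test formulas of the set `T`. -/
def SatisfiesTests (q : Φ) (i : Agent) {k : ℕ} (T : Set (Formula Φ)) (π : World Φ × Str Φ k) :
    Prop :=
  ∀ β, IsTest q i k β → β ∈ T → HoldsAt i π β

/-- A test formula outside a theory is refuted at a pair that satisfies the test formulas in the
theory, and `q` may be made true or false there. -/
theorem IsTheory.exists_satisfiesTests {T : Set (Formula Φ)} (hT : IsTheory T) {q : Φ} {i : Agent}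
    {k : ℕ} {β : Formula Φ} (hβ : IsTest q i k β) (hn : β ∉ T) (P : Prop) :
    ∃ π : World Φ × Str Φ k, SatisfiesTests q i T π ∧ ¬ HoldsAt i π β ∧ (q ∈ π.1 ↔ P) := by
  obtain ⟨Δ, hΔ, hβΔ⟩ := hT.exists_completeTheory hn
  have hw : ∀ p, p ≠ q → (p ∈ {p | (p ≠ q ∧ p ∈ Δ.world) ∨ (p = q ∧ P)} ↔ p ∈ Δ.world) := by
    intro p hp
    simp [hp]
  refine ⟨({p | (p ≠ q ∧ p ∈ Δ.world) ∨ (p = q ∧ P)}, CompleteTheory.basicStr i.other k Δ),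
    fun γ hγ hγT => ?_, ?_, by simp⟩
  · rw [hγ.holdsAt_congr _ hw, hγ.holdsAt_basicStr]
    exact hΔ γ hγT
  · rwa [hβ.holdsAt_congr _ hw, hβ.holdsAt_basicStr]

namespace CompleteTheory

variable (Γ : CompleteTheory Φ)

/-- The `k`-structure of agent `i` for a complete theory `Γ` and an atom `q` that plays no role in
the formulas of interest. The atom separates the pairs inside from those outside the structure
among the pairs that satisfy both what is known and what holds at all other pairs. -/
def fullStr (q : Φ) (i : Agent) : (k : ℕ) → Str Φ k
  | 0 => PUnit.unit
  | _ + 1 => {π | SatisfiesTests q i {β | L i β ∈ Γ} π ∧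
      (SatisfiesTests q i {β | N i β ∈ Γ} π → q ∈ π.1)}

variable {Γ} {q : Φ} {i : Agent} {k : ℕ}

theorem mem_pairs_fullStr {π : World Φ × Str Φ k} :
    π ∈ (Γ.fullStr q i (k + 1)).pairs ↔ SatisfiesTests q i {β | L i β ∈ Γ} π ∧
      (SatisfiesTests q i {β | N i β ∈ Γ} π → q ∈ π.1) :=
  Iff.rfl

/-- This is where axiom A5 is used. -/
theorem satisfiesTests_L_or_N (π : World Φ × Str Φ k) :
    SatisfiesTests q i {β | L i β ∈ Γ} π ∨ SatisfiesTests q i {β | N i β ∈ Γ} π := by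
  by_contra! h
  obtain ⟨h₁, h₂⟩ := h
  simp only [SatisfiesTests, not_forall] at h₁ h₂
  obtain ⟨β, hβ, hβΓ, hβn⟩ := h₁
  obtain ⟨γ, hγ, hγΓ, hγn⟩ := h₂
  have hL : L i (Formula.or β γ) ∈ Γ := by
    refine (Γ.isTheory.unboxL i).taut_mp (fun v => ?_) hβΓ
    simp only [imp, PropTrue]
    tauto
  have hN : N i (Formula.or β γ) ∈ Γ := by
    refine (Γ.isTheory.unboxN i).taut_mp (fun v => ?_) hγΓ
    simp only [imp, PropTrue]
    tauto
  have hcons : K45Consistent (neg (Formula.or β γ)) := by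
    intro hp
    have hs : SatFor i (neg (neg (Formula.or β γ))) 0 k PUnit.unit π.2 π.1 := by
      cases i <;> exact hp.sat _ _ _ _ _
    have hor := satFor_or.1 (not_not.1 fun h => satFor_neg.1 hs (satFor_neg.2 h))
    exact hor.elim hβn hγn
  have hbasic : IsBasic (neg (Formula.or β γ)) := fun l hl =>
    hl.elim (hβ.isBasic l) (hγ.isBasic l)
  refine (Γ.neg_mem _).1 (Γ.isTheory.mp (Γ.isTheory.provable ?_) hN) hL
  exact .a5 i _ hbasic ⟨hβ.isObjective, hγ.isObjective⟩ hcons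

theorem L_mem_iff_fullStr {β : Formula Φ} (hβ : IsTest q i k β) :
    L i β ∈ Γ ↔ ∀ π ∈ (Γ.fullStr q i (k + 1)).pairs, HoldsAt i π β := by
  refine ⟨fun h π hπ => (mem_pairs_fullStr.1 hπ).1 β hβ h, fun h => ?_⟩
  by_contra hn
  obtain ⟨π, hπ, hπβ, hq⟩ := (Γ.isTheory.unboxL i).exists_satisfiesTests hβ hn True
  exact hπβ (h π (mem_pairs_fullStr.2 ⟨hπ, fun _ => hq.2 trivial⟩))

theorem N_mem_iff_fullStr {β : Formula Φ} (hβ : IsTest q i k β) :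
    N i β ∈ Γ ↔ ∀ π ∉ (Γ.fullStr q i (k + 1)).pairs, HoldsAt i π β := by
  constructor
  · intro h π hπ
    rw [mem_pairs_fullStr] at hπ
    by_contra hn
    have hN : ¬ SatisfiesTests q i {β | N i β ∈ Γ} π := fun hs => hn (hs β hβ h)
    exact hπ ⟨(satisfiesTests_L_or_N π).resolve_right hN, fun hs => absurd hs hN⟩
  · intro h
    by_contra hn
    obtain ⟨π, hπ, hπβ, hq⟩ := (Γ.isTheory.unboxN i).exists_satisfiesTests hβ hn False
    exact hπβ (h π fun hmem => hq.1 ((mem_pairs_fullStr.1 hmem).2 hπ))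

/-! ### Removing nested operators of the same agent -/

open Classical in
/-- The truth constant, built from the atom `p`, for the statement that `α` is in `Γ`. -/
noncomputable def constFor (Γ : CompleteTheory Φ) (p : Φ) (α : Formula Φ) : Formula Φ :=
  if α ∈ Γ then Formula.or (atom p) (neg (atom p)) else neg (Formula.or (atom p) (neg (atom p)))

/-- Replace the outermost subformulas that start with an operator of agent `i` by truth constants,
according to whether they are in `Γ`. -/
noncomputable def reduce (Γ : CompleteTheory Φ) (p : Φ) (i : Agent) : Formula Φ → Formula Φ
  | .atom p' => atom p'
  | .neg α => neg (reduce Γ p i α)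
  | .or α β => Formula.or (reduce Γ p i α) (reduce Γ p i β)
  | .L l α => if l = i then constFor Γ p (L l α) else L l α
  | .N l α => if l = i then constFor Γ p (N l α) else N l α

variable {p : Φ}

theorem satFor_constFor {l : Agent} {α : Formula Φ} {k m : ℕ} {e : Str Φ k} {e' : Str Φ m}
    {w : World Φ} : SatFor l (constFor Γ p α) k m e e' w ↔ α ∈ Γ := by
  unfold constFor
  split_ifs with h <;> simp only [satFor_neg, satFor_or, satFor_atom, h] <;> tauto

theorem isTest_constFor (hp : p ≠ q) (α : Formula Φ) : IsTest q i k (constFor Γ p α) := by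
  unfold constFor
  split_ifs <;> constructor <;> simp [IsBasic, OccursN, IsObjective, Mentions, rank, hp]

theorem isTest_reduce (hp : p ≠ q) {α : Formula Φ} (hα : α.IsONLMinus)
    (hN : ¬ α.OccursN i.other) (hq : ¬ α.Mentions q) (hk : α.rank i.other ≤ k) :
    IsTest q i k (Γ.reduce p i α) := by
  induction α with
  | atom p' => exact ⟨fun _ h => h, trivial, hq, hk⟩
  | neg α ih =>
    have h := ih hα hN hq hk
    exact ⟨h.1, h.2, h.3, h.4⟩
  | or α β ihα ihβ =>
    simp only [rank, max_le_iff] at hk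
    have h₁ := ihα hα.1 (fun h => hN (Or.inl h)) (fun h => hq (Or.inl h)) hk.1
    have h₂ := ihβ hα.2 (fun h => hN (Or.inr h)) (fun h => hq (Or.inr h)) hk.2
    exact ⟨fun l hl => hl.elim (h₁.1 l) (h₂.1 l), ⟨h₁.2, h₂.2⟩, fun h => h.elim h₁.3 h₂.3,
      max_le h₁.4 h₂.4⟩
  | L l α _ =>
    rcases l.eq_or_eq_other i with rfl | rfl
    · simp only [reduce, if_true]
      exact isTest_constFor hp _
    · simp only [reduce, if_neg (Agent.other_ne i)]
      refine ⟨fun l hl => ?_, Agent.other_ne i, hq, hk⟩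
      rcases l.eq_or_eq_other i with rfl | rfl
      · exact hα.2 l (Agent.other_ne l).symm hl
      · exact hN hl
  | N l α _ =>
    rcases l.eq_or_eq_other i with rfl | rfl
    · simp only [reduce, if_true]
      exact isTest_constFor hp _
    · exact absurd (Or.inl rfl) hN

theorem imp_constFor_mem {T : Set (Formula Φ)} (hT : IsTheory T)
    (hsub : ∀ σ, σ.IsSubjective i → σ ∈ Γ → σ ∈ T) {σ : Formula Φ} (hσ : σ.IsSubjective i) :
    imp σ (constFor Γ p σ) ∈ T ∧ imp (constFor Γ p σ) σ ∈ T := by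
  unfold constFor
  split_ifs with h
  · refine ⟨hT.taut fun v => ?_, hT.taut_mp (fun v => ?_) (hsub σ hσ h)⟩ <;>
      simp only [imp, PropTrue] <;> tauto
  · refine ⟨hT.taut_mp (fun v => ?_) (hsub (neg σ) hσ ((Γ.neg_mem σ).2 h)), hT.taut fun v => ?_⟩ <;>
      simp only [imp, PropTrue] <;> tauto

theorem imp_reduce_mem {T : Set (Formula Φ)} (hT : IsTheory T)
    (hsub : ∀ σ, σ.IsSubjective i → σ ∈ Γ → σ ∈ T) (α : Formula Φ) :
    imp α (Γ.reduce p i α) ∈ T ∧ imp (Γ.reduce p i α) α ∈ T := by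
  induction α with
  | atom p' =>
    refine ⟨hT.taut fun v => ?_, hT.taut fun v => ?_⟩ <;>
      simp only [imp, reduce, PropTrue] <;> tauto
  | neg α ih =>
    refine ⟨hT.taut_mp (fun v => ?_) ih.2, hT.taut_mp (fun v => ?_) ih.1⟩ <;>
      simp only [imp, reduce, PropTrue] <;> tauto
  | or α β ihα ihβ =>
    refine ⟨hT.taut_mp₂ (fun v => ?_) ihα.1 ihβ.1, hT.taut_mp₂ (fun v => ?_) ihα.2 ihβ.2⟩ <;>
      simp only [imp, reduce, PropTrue] <;> tauto
  | L l α _ | N l α _ =>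
    by_cases hl : l = i
    · simp only [reduce, if_pos hl]
      exact imp_constFor_mem hT hsub hl
    · simp only [reduce, if_neg hl]
      refine ⟨hT.taut fun v => ?_, hT.taut fun v => ?_⟩ <;> simp only [imp, PropTrue] <;> tauto

/-- For the theories `{α | L_i α ∈ Γ}` and `{α | N_i α ∈ Γ}` the hypothesis `hsub` is axiom A4. -/
theorem mem_iff_reduce_mem {T : Set (Formula Φ)} (hT : IsTheory T)
    (hsub : ∀ σ, σ.IsSubjective i → σ ∈ Γ → σ ∈ T) (α : Formula Φ) :
    α ∈ T ↔ Γ.reduce p i α ∈ T :=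
  ⟨hT.mp (imp_reduce_mem hT hsub α).1, hT.mp (imp_reduce_mem hT hsub α).2⟩

/-! ### Truth at the full structures -/

/-- The step of `satFor_reduce` for an operator, also used on its own: an operator of agent `i` is
interpreted correctly as soon as reduction preserves the truth of its argument. -/
theorem satFor_fullStr_L_of_reduce (hp : p ≠ q) {α : Formula Φ} (hα : (L i α).IsONLMinus)
    (hq : ¬ α.Mentions q) (hk : α.rank i.other ≤ k)
    (h : ∀ (w : World Φ) (f : Str Φ k), SatFor i α (k + 1) k (Γ.fullStr q i (k + 1)) f w ↔
      SatFor i (Γ.reduce p i α) (k + 1) k (Γ.fullStr q i (k + 1)) f w)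
    {m : ℕ} {e' : Str Φ m} {w : World Φ} :
    SatFor i (L i α) (k + 1) m (Γ.fullStr q i (k + 1)) e' w ↔ L i α ∈ Γ := by
  have ht : IsTest q i k (Γ.reduce p i α) :=
    isTest_reduce hp hα.1 (hα.2 _ (Agent.other_ne i)) hq hk
  have hr : L i α ∈ Γ ↔ L i (Γ.reduce p i α) ∈ Γ :=
    mem_iff_reduce_mem (Γ.isTheory.unboxL i)
      (fun σ hσ h => (Γ.isTheory.mem_of_isSubjective hσ h).1) α
  rw [hr, L_mem_iff_fullStr ht, satFor_L, Prod.forall]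
  exact forall₂_congr fun w f => imp_congr_right fun _ => (h w f).trans (ht.satFor_iff _ (w, f))

theorem satFor_fullStr_N_of_reduce (hp : p ≠ q) {α : Formula Φ} (hα : (N i α).IsONLMinus)
    (hq : ¬ α.Mentions q) (hk : α.rank i.other ≤ k)
    (h : ∀ (w : World Φ) (f : Str Φ k), SatFor i α (k + 1) k (Γ.fullStr q i (k + 1)) f w ↔
      SatFor i (Γ.reduce p i α) (k + 1) k (Γ.fullStr q i (k + 1)) f w)
    {m : ℕ} {e' : Str Φ m} {w : World Φ} :
    SatFor i (N i α) (k + 1) m (Γ.fullStr q i (k + 1)) e' w ↔ N i α ∈ Γ := by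
  have ht : IsTest q i k (Γ.reduce p i α) :=
    isTest_reduce hp hα.1 (hα.2 _ (Agent.other_ne i)) hq hk
  have hr : N i α ∈ Γ ↔ N i (Γ.reduce p i α) ∈ Γ :=
    mem_iff_reduce_mem (Γ.isTheory.unboxN i)
      (fun σ hσ h => (Γ.isTheory.mem_of_isSubjective hσ h).2) α
  rw [hr, N_mem_iff_fullStr ht, satFor_N, Prod.forall]
  exact forall₂_congr fun w f => imp_congr_right fun _ => (h w f).trans (ht.satFor_iff _ (w, f))

theorem satFor_reduce (hp : p ≠ q) {α : Formula Φ} (hα : α.IsONLMinus)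
    (hq : ¬ α.Mentions q) (hk : α.rank i ≤ k + 1) {m : ℕ} {e' : Str Φ m} {w : World Φ} :
    SatFor i α (k + 1) m (Γ.fullStr q i (k + 1)) e' w ↔
      SatFor i (Γ.reduce p i α) (k + 1) m (Γ.fullStr q i (k + 1)) e' w := by
  induction α generalizing m w with
  | atom p' => rfl
  | neg α ih => simp only [reduce, satFor_neg, ih hα hq hk]
  | or α β ihα ihβ =>
    simp only [rank, max_le_iff] at hk
    simp only [reduce, satFor_or, ihα hα.1 (fun h => hq (Or.inl h)) hk.1,
      ihβ hα.2 (fun h => hq (Or.inr h)) hk.2]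
  | L l α ih =>
    by_cases hl : l = i
    · subst hl
      simp only [rank, if_true, max_le_iff] at hk
      simp only [reduce, if_true, satFor_constFor]
      exact satFor_fullStr_L_of_reduce hp hα hq (by omega) fun w f => ih hα.1 hq hk.1
    · simp only [reduce, if_neg hl]
  | N l α ih =>
    by_cases hl : l = i
    · subst hl
      simp only [rank, if_true, max_le_iff] at hk
      simp only [reduce, if_true, satFor_constFor]
      exact satFor_fullStr_N_of_reduce hp hα hq (by omega) fun w f => ih hα.1 hq hk.1
    · simp only [reduce, if_neg hl]

/-- Truth lemma for `ONL_n^-`. -/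
theorem satFor_fullStr (hp : p ≠ q) {α : Formula Φ} (hα : α.IsONLMinus) (hq : ¬ α.Mentions q)
    (i : Agent) {k m : ℕ} (hk : α.rank i ≤ k) (hm : α.rank i.other ≤ m) :
    SatFor i α k m (Γ.fullStr q i k) (Γ.fullStr q i.other m) Γ.world ↔ α ∈ Γ := by
  induction α with
  | atom p' => exact satFor_atom
  | neg α ih => rw [satFor_neg, neg_mem, ih hα hq hk hm]
  | or α β ihα ihβ =>
    simp only [rank, max_le_iff] at hk hm
    rw [satFor_or, or_mem, ihα hα.1 (fun h => hq (Or.inl h)) hk.1 hm.1,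
      ihβ hα.2 (fun h => hq (Or.inr h)) hk.2 hm.2]
  | L l α _ =>
    have key : ∀ {k m : ℕ} (e' : Str Φ m), (L l α).rank l ≤ k →
        (SatFor l (L l α) k m (Γ.fullStr q l k) e' Γ.world ↔ L l α ∈ Γ) := by
      intro k m e' hk
      simp only [rank, if_true, max_le_iff] at hk
      obtain ⟨k, rfl⟩ : ∃ k', k = k' + 1 := ⟨k - 1, by omega⟩
      exact satFor_fullStr_L_of_reduce hp hα hq (by omega) fun w f =>
        satFor_reduce hp hα.1 hq hk.1
    rcases l.eq_or_eq_other i with rfl | rfl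
    · exact key _ hk
    · rw [← satFor_other]
      exact key _ hm
  | N l α _ =>
    have key : ∀ {k m : ℕ} (e' : Str Φ m), (N l α).rank l ≤ k →
        (SatFor l (N l α) k m (Γ.fullStr q l k) e' Γ.world ↔ N l α ∈ Γ) := by
      intro k m e' hk
      simp only [rank, if_true, max_le_iff] at hk
      obtain ⟨k, rfl⟩ : ∃ k', k = k' + 1 := ⟨k - 1, by omega⟩
      exact satFor_fullStr_N_of_reduce hp hα hq (by omega) fun w f =>
        satFor_reduce hp hα.1 hq hk.1
    rcases l.eq_or_eq_other i with rfl | rfl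
    · exact key _ hk
    · rw [← satFor_other]
      exact key _ hm

end CompleteTheory

/-! ### Completeness -/

theorem AXConsistent.satisfiableAt [Infinite Φ] {α : Formula Φ} (hcons : AXConsistent α)
    (hα : α.IsONLMinus) {k j : ℕ} (hk : α.depth .a ≤ k) (hj : α.depth .b ≤ j) :
    SatisfiableAt α k j := by
  obtain ⟨Γ, -, hΓ⟩ := isTheory_setOf_axProvable.exists_completeTheory hcons
  rw [Γ.neg_mem, not_not] at hΓ
  obtain ⟨q, hq⟩ := (finite_mentions α).exists_notMem
  obtain ⟨p, hp⟩ := exists_ne q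
  exact ⟨Γ.fullStr q .a k, Γ.fullStr q .b j, Γ.world,
    (CompleteTheory.satFor_fullStr hp hα hq .a ((α.rank_le_depth .a).1.trans hk)
      ((α.rank_le_depth .b).1.trans hj)).2 hΓ⟩

theorem Valid.axProvable [Infinite Φ] {α : Formula Φ} (hv : Valid α) (hα : α.IsONLMinus) :
    AXProvable α := by
  by_contra hn
  have hcons : AXConsistent (neg α) := by
    refine fun h => hn (isTheory_setOf_axProvable.taut_mp (fun v => ?_) h)
    simp only [imp, PropTrue]
    tauto
  obtain ⟨ea, eb, w, h⟩ := hcons.satisfiableAt hα le_rfl le_rfl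
  exact h (hv ea eb w)

end OnlyKnowing

theorem mainTheorem3 {Φ : Type u} [Infinite Φ] (α : OnlyKnowing.Formula Φ)
    (hα : α.IsONLMinus) :
    (OnlyKnowing.Valid α → OnlyKnowing.AXProvable α) ∧
      (OnlyKnowing.AXConsistent α →
        OnlyKnowing.SatisfiableAt α (2 * α.depth .a + 1) (2 * α.depth .b + 1)) := by
  refine ⟨fun hv => hv.axProvable hα, fun hcons => hcons.satisfiableAt hα ?_ ?_⟩ <;> omega
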